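/- Let $n$ be a natural number and $\hbar>0$. Write $z=(x,p)\in\mathbb{R}^{2n}=\mathbb{R}^n\times\mathbb{R}^n$, $xp=\sum_{j=1}^n x_jp_j$, $\sigma(z,z')=p\cdot x'-x\cdot p'$, and let $$\Theta(z)=\frac{\sin(xp/2\hbar)}{xp/2\hbar}\quad\text{if } xp\neq 0,\qquad \Theta(z)=1\quad\text{if } xp=0 .$$ For $\varphi\in\mathcal{S}(\mathbb{R}^{2n})$ let $\varphi_\sigma(z)=(2\pi\hbar)^{-n}\int_{\mathbb{R}^{2n}}e^{-\frac{i}{\hbar}\sigma(z,z')}\varphi(z')\,dz'$ be the symplectic Fourier transform, extended to $\mathcal{S}'(\mathbb{R}^{2n})$ by duality, and let $\Theta_\sigma\in\mathcal{S}'(\mathbb{R}^{2n})$ be the symplectic Fourier transform of $\Theta$. For every $\varphi\in\mathcal{S}(\mathbb{R}^{2n})$ the function $z\mapsto\langle\Theta_\sigma,\varphi(z+\cdot)\rangle$ belongs to $\mathcal{S}(\mathbb{R}^{2n})$ and depends continuously on $\varphi$, so that for $a\in\mathcal{S}'(\mathbb{R}^{2n})$ the convolution $a*\Theta_\sigma\in\mathcal{S}'(\mathbb{R}^{2n})$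 is defined by $\langle a*\Theta_\sigma,\varphi\rangle=\langle a_z,\langle\Theta_\sigma,\varphi(z+\cdot)\rangle\rangle$. Then the map $$\mathcal{S}'(\mathbb{R}^{2n})\to\mathcal{S}'(\mathbb{R}^{2n}),\qquad a\longmapsto\left(\tfrac{1}{2\pi\hbar}\right)^n a*\Theta_\sigma$$ is surjective, that is, for every $b\in\mathcal{S}'(\mathbb{R}^{2n})$ the equation $\left(\tfrac{1}{2\pi\hbar}\right)^n a*\Theta_\sigma=b$ has a solution $a\in\mathcal{S}'(\mathbb{R}^{2n})$. Likewise, for every $b\in\mathcal{S}'(\mathbb{R}^{2n})$ the division equation $\Theta a=b$ has a solution $a\in\mathcal{S}'(\mathbb{R}^{2n})$. -/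

import Mathlib

open MeasureTheory SchwartzMap
open scoped SchwartzMap FourierTransform

noncomputable section

namespace BornJordan

/-- Phase space `ℝ²ⁿ = ℝⁿ × ℝⁿ` with its Euclidean norm and Lebesgue measure; for `z = (x, p)` the
coordinate `xⱼ` is `z (Sum.inl j)` and the coordinate `pⱼ` is `z (Sum.inr j)`. -/
abbrev PhaseSpace (n : ℕ) : Type := EuclideanSpace ℝ (Fin n ⊕ Fin n)

variable {n : ℕ}

/-- The product `xp = ∑ⱼ xⱼ pⱼ` for `z = (x, p)`. -/
def dotXP (z : PhaseSpace n) : ℝ := ∑ j : Fin n, z (Sum.inl j) * z (Sum.inr j)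

/-- The symplectic form `σ(z, z') = p · x' - x · p'`. -/
def sympl (z z' : PhaseSpace n) : ℝ :=
  (∑ j : Fin n, z (Sum.inr j) * z' (Sum.inl j)) - ∑ j : Fin n, z (Sum.inl j) * z' (Sum.inr j)

/-- Cohen's kernel function `Θ(x, p) = sin(xp/2ℏ) / (xp/2ℏ)`, with value `1` where `xp = 0`. -/
def theta (n : ℕ) (ℏ : ℝ) (z : PhaseSpace n) : ℂ := (Real.sinc (dotXP z / (2 * ℏ)) : ℂ)

theorem hasTemperateGrowth_sinc : (fun t : ℝ => (Real.sinc t : ℂ)).HasTemperateGrowth := by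
  set μ : Measure ℝ := volume.restrict (Set.Ioc (-1) 1) with hμ
  have hsinc : (fun t : ℝ => (Real.sinc t : ℂ)) = fun t => (1 / 2 : ℂ) * charFun μ t := by
    funext t
    have h : charFun μ t = ∫ x in (-1 : ℝ)..1, Complex.exp (t * x * Complex.I) := by
      rw [charFun_apply_real, intervalIntegral.integral_of_le (by norm_num)]
    rw [h]
    by_cases ht : t = 0
    · subst ht; simp; norm_num
    · have h1 := integral_exp_mul_I_eq_sinc t
      have h2 := intervalIntegral.integral_comp_mul_left (a := -1) (b := 1)
        (fun x : ℝ => Complex.exp (x * Complex.I)) ht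
      simp only [Complex.ofReal_mul, mul_neg, mul_one] at h2
      rw [h2, h1, Complex.real_smul]
      have : (t : ℂ) ≠ 0 := by exact_mod_cast ht
      push_cast
      field_simp
  have hmem : ∀ k : ℕ, MemLp id k μ := by
    intro k
    refine MemLp.of_bound (by fun_prop) 1 ?_
    rw [hμ]
    refine (ae_restrict_mem measurableSet_Ioc).mono fun x hx => ?_
    rw [id, Real.norm_eq_abs, abs_le]
    exact ⟨hx.1.le, hx.2⟩
  have hchar : (charFun μ).HasTemperateGrowth := by
    refine ⟨contDiff_charFun' hmem, fun k => ⟨0, ∫ x, ‖(x : ℂ) ^ k‖ ∂μ, fun t => ?_⟩⟩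
    rw [norm_iteratedFDeriv_eq_norm_iteratedDeriv, iteratedDeriv_charFun (hmem k)]
    simp only [norm_mul, norm_pow, Complex.norm_I, one_pow, one_mul, pow_zero, mul_one]
    refine (norm_integral_le_integral_norm _).trans (le_of_eq ?_)
    congr 1
    funext x
    have : ‖Complex.exp (t * x * Complex.I)‖ = 1 := by
      rw [← Complex.ofReal_mul]; exact Complex.norm_exp_ofReal_mul_I _
    simp [this]
  rw [hsinc]
  exact (Function.HasTemperateGrowth.const _).mul hchar

theorem hasTemperateGrowth_coord (i : Fin n ⊕ Fin n) :
    (fun z : PhaseSpace n => z i).HasTemperateGrowth :=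
  (EuclideanSpace.proj i : PhaseSpace n →L[ℝ] ℝ).hasTemperateGrowth

theorem hasTemperateGrowth_theta (n : ℕ) (ℏ : ℝ) : (theta n ℏ).HasTemperateGrowth := by
  have h : (fun z : PhaseSpace n => dotXP z / (2 * ℏ)).HasTemperateGrowth := by
    have h1 : (dotXP : PhaseSpace n → ℝ).HasTemperateGrowth :=
      Function.HasTemperateGrowth.sum fun j _ =>
        (hasTemperateGrowth_coord (Sum.inl j)).mul (hasTemperateGrowth_coord (Sum.inr j))
    simpa only [div_eq_mul_inv] using! h1.mul (Function.HasTemperateGrowth.const (2 * ℏ)⁻¹)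
  exact hasTemperateGrowth_sinc.comp h

/-- The matrix `J = (0, I; -I, 0)` divided by `2πℏ`: the linear map
`(x, p) ↦ (p, -x) / (2πℏ)`. -/
def scaledJ (n : ℕ) {ℏ : ℝ} (hℏ : 0 < ℏ) : PhaseSpace n ≃L[ℝ] PhaseSpace n :=
  LinearEquiv.toContinuousLinearEquiv
    { toFun := fun z => WithLp.toLp 2 (Sum.elim
        (fun j => (2 * Real.pi * ℏ)⁻¹ * z (Sum.inr j))
        (fun j => -((2 * Real.pi * ℏ)⁻¹ * z (Sum.inl j))))
      invFun := fun z => WithLp.toLp 2 (Sum.elim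
        (fun j => -(2 * Real.pi * ℏ * z (Sum.inr j)))
        (fun j => 2 * Real.pi * ℏ * z (Sum.inl j)))
      map_add' := fun z w => by ext (j | j) <;> simp <;> ring
      map_smul' := fun c z => by ext (j | j) <;> simp <;> ring
      left_inv := fun z => by
        have := Real.pi_pos
        ext (j | j) <;> simp <;> field_simp
      right_inv := fun z => by
        have := Real.pi_pos
        ext (j | j) <;> simp <;> field_simp }

theorem inner_scaledJ {ℏ : ℝ} (hℏ : 0 < ℏ) (z z' : PhaseSpace n) :
    inner ℝ z' (scaledJ n hℏ z) = (2 * Real.pi * ℏ)⁻¹ * sympl z z' := by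
  have h1 : ∀ j, scaledJ n hℏ z (Sum.inl j) = (2 * Real.pi * ℏ)⁻¹ * z (Sum.inr j) := fun _ => rfl
  have h2 : ∀ j, scaledJ n hℏ z (Sum.inr j) = -((2 * Real.pi * ℏ)⁻¹ * z (Sum.inl j)) :=
    fun _ => rfl
  rw [PiLp.inner_apply, Fintype.sum_sum_type, sympl, mul_sub, Finset.mul_sum, Finset.mul_sum,
    sub_eq_add_neg, ← Finset.sum_neg_distrib]
  congr 1 <;> refine Finset.sum_congr rfl fun j _ => ?_
  · rw [h1]; simp; ring
  · rw [h2]; simp; ring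

/-- The symplectic Fourier transform of a Schwartz function, see `symplFourier_apply`. -/
def symplFourier (n : ℕ) {ℏ : ℝ} (hℏ : 0 < ℏ) :
    𝓢(PhaseSpace n, ℂ) →L[ℂ] 𝓢(PhaseSpace n, ℂ) :=
  ((1 / (2 * Real.pi * ℏ : ℂ)) ^ n) •
    ((compCLMOfContinuousLinearEquiv ℂ (scaledJ n hℏ)).comp
      (FourierTransform.fourierCLM ℂ 𝓢(PhaseSpace n, ℂ)))

/-- `F_σ φ(z) = (2πℏ)⁻ⁿ ∫ exp(-(i/ℏ) σ(z, z')) φ(z') dz'`. -/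
theorem symplFourier_apply {ℏ : ℝ} (hℏ : 0 < ℏ) (φ : 𝓢(PhaseSpace n, ℂ)) (z : PhaseSpace n) :
    symplFourier n hℏ φ z = (1 / (2 * Real.pi * ℏ : ℂ)) ^ n *
      ∫ z', Complex.exp (-(Complex.I / ℏ) * sympl z z') * φ z' := by
  have h1 : symplFourier n hℏ φ z =
      (1 / (2 * Real.pi * ℏ : ℂ)) ^ n * 𝓕 (φ : PhaseSpace n → ℂ) (scaledJ n hℏ z) := rfl
  rw [h1, Real.fourier_eq']
  congr 2
  funext z'
  rw [inner_scaledJ, smul_eq_mul]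
  have h2 : (Real.pi : ℂ) ≠ 0 := by exact_mod_cast Real.pi_ne_zero
  have h3 : (ℏ : ℂ) ≠ 0 := by exact_mod_cast hℏ.ne'
  congr 2
  push_cast
  field_simp

/-- Reflection `φ(z) ↦ φ(-z)` on Schwartz functions. -/
def reflect (n : ℕ) : 𝓢(PhaseSpace n, ℂ) →L[ℂ] 𝓢(PhaseSpace n, ℂ) :=
  compCLMOfContinuousLinearEquiv ℂ (ContinuousLinearEquiv.neg ℝ)

/-- The transpose `φ ↦ (2πℏ)⁻ⁿ ∫ exp((i/ℏ) σ(·, z')) φ(z') dz'` of the symplectic Fourier transform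
with respect to the pairing `(φ, ψ) ↦ ∫ φ ψ`, see `integral_symplFourier_mul`. -/
def symplFourierTranspose (n : ℕ) {ℏ : ℝ} (hℏ : 0 < ℏ) :
    𝓢(PhaseSpace n, ℂ) →L[ℂ] 𝓢(PhaseSpace n, ℂ) :=
  (reflect n).comp (symplFourier n hℏ)

theorem symplFourierTranspose_apply {ℏ : ℝ} (hℏ : 0 < ℏ) (φ : 𝓢(PhaseSpace n, ℂ))
    (z : PhaseSpace n) :
    symplFourierTranspose n hℏ φ z = (1 / (2 * Real.pi * ℏ : ℂ)) ^ n *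
      ∫ z', Complex.exp ((Complex.I / ℏ) * sympl z z') * φ z' := by
  have h : symplFourierTranspose n hℏ φ z = symplFourier n hℏ φ (-z) := rfl
  have h' : ∀ z' : PhaseSpace n, sympl (-z) z' = -sympl z z' := fun z' => by
    simp [sympl]; ring
  simp [h, symplFourier_apply, h']

theorem integral_symplFourier_mul {ℏ : ℝ} (hℏ : 0 < ℏ) (φ ψ : 𝓢(PhaseSpace n, ℂ)) :
    ∫ z, symplFourier n hℏ φ z * ψ z = ∫ z, φ z * symplFourierTranspose n hℏ ψ z := by
  have h2 : (Real.pi : ℂ) ≠ 0 := by exact_mod_cast Real.pi_ne_zero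
  have h3 : (ℏ : ℂ) ≠ 0 := by exact_mod_cast hℏ.ne'
  let L : PhaseSpace n →L[ℝ] PhaseSpace n →L[ℝ] ℝ :=
    (innerSL ℝ).flip.comp (scaledJ n hℏ : PhaseSpace n →L[ℝ] PhaseSpace n) |>.flip
  have hL : ∀ v w, L v w = (2 * Real.pi * ℏ)⁻¹ * sympl w v := fun v w => inner_scaledJ hℏ w v
  have hs : ∀ v w : PhaseSpace n, sympl v w = -sympl w v := fun v w => by
    simp only [sympl, neg_sub, mul_comm]
  have key := VectorFourier.integral_fourierIntegral_smul_eq_flip (μ := volume) (ν := volume)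
    (L := L.toLinearMap₁₂) (f := φ) (g := ψ) Real.continuous_fourierChar
    (L.continuous₂) φ.integrable ψ.integrable
  have e1 : ∀ z, symplFourier n hℏ φ z = (1 / (2 * Real.pi * ℏ : ℂ)) ^ n *
      VectorFourier.fourierIntegral Real.fourierChar volume L.toLinearMap₁₂ φ z := fun z => by
    rw [symplFourier_apply, VectorFourier.fourierIntegral]
    congr 2
    funext v
    rw [Circle.smul_def, Real.fourierChar_apply, smul_eq_mul,
      ContinuousLinearMap.toLinearMap₁₂_apply_apply_apply, hL]
    congr 2
    push_cast
    field_simp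
  have e2 : ∀ z, symplFourierTranspose n hℏ ψ z = (1 / (2 * Real.pi * ℏ : ℂ)) ^ n *
      VectorFourier.fourierIntegral Real.fourierChar volume L.toLinearMap₁₂.flip ψ z := fun z => by
    rw [symplFourierTranspose_apply, VectorFourier.fourierIntegral]
    congr 2
    funext v
    rw [Circle.smul_def, Real.fourierChar_apply, smul_eq_mul, LinearMap.flip_apply,
      ContinuousLinearMap.toLinearMap₁₂_apply_apply_apply, hL, hs]
    congr 2
    push_cast
    field_simp
  simp only [e1, e2, mul_assoc, mul_left_comm (φ _), integral_const_mul]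
  rw [← smul_eq_mul, ← smul_eq_mul]
  congr 1

/-- The symplectic Fourier transform of a tempered distribution, by duality. -/
def symplFourierDistrib (n : ℕ) {ℏ : ℝ} (hℏ : 0 < ℏ) :
    𝓢'(PhaseSpace n, ℂ) →L[ℂ] 𝓢'(PhaseSpace n, ℂ) :=
  PointwiseConvergenceCLM.precomp ℂ (symplFourierTranspose n hℏ)

/-- The tempered distribution `Θ`, i.e. `φ ↦ ∫ φ Θ`. -/
def thetaDistrib (n : ℕ) (ℏ : ℝ) : 𝓢'(PhaseSpace n, ℂ) :=
  Function.HasTemperateGrowth.toTemperedDistribution volume (hasTemperateGrowth_theta n ℏ)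

/-- The tempered distribution `Θ_σ`, the symplectic Fourier transform of `Θ`. -/
def thetaSigma (n : ℕ) {ℏ : ℝ} (hℏ : 0 < ℏ) : 𝓢'(PhaseSpace n, ℂ) :=
  symplFourierDistrib n hℏ (thetaDistrib n ℏ)

/-- `T` is a convolutor of the Schwartz space: for every test function `φ` the function
`z ↦ ⟨T, φ(z + ·)⟩` is a Schwartz function that depends continuously on `φ`. These are the
tempered distributions with which every tempered distribution can be convolved. -/
def IsConvolutor (T : 𝓢'(PhaseSpace n, ℂ)) : Prop :=
  ∃ L : 𝓢(PhaseSpace n, ℂ) →L[ℂ] 𝓢(PhaseSpace n, ℂ),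
    ∀ φ z, L φ z = T (compSubConstCLM ℂ (-z) φ)

/-- The convolution `a * T` of a tempered distribution with a convolutor,
`⟨a * T, φ⟩ = ⟨a_z, ⟨T_w, φ(z + w)⟩⟩`. -/
def conv (a T : 𝓢'(PhaseSpace n, ℂ)) (hT : IsConvolutor T) : 𝓢'(PhaseSpace n, ℂ) :=
  PointwiseConvergenceCLM.precomp ℂ hT.choose a

theorem conv_apply (a T : 𝓢'(PhaseSpace n, ℂ)) (hT : IsConvolutor T)
    (φ ψ : 𝓢(PhaseSpace n, ℂ)) (hψ : ∀ z, ψ z = T (compSubConstCLM ℂ (-z) φ)) :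
    conv a T hT φ = a ψ := by
  have h : hT.choose φ = ψ := by
    ext z
    rw [hT.choose_spec, hψ]
  rw [← h]
  rfl

theorem symplFourierTranspose_translate {ℏ : ℝ} (hℏ : 0 < ℏ) (φ : 𝓢(PhaseSpace n, ℂ))
    (z w : PhaseSpace n) :
    symplFourierTranspose n hℏ (compSubConstCLM ℂ (-z) φ) w =
      Complex.exp ((Complex.I / ℏ) * sympl z w) * symplFourierTranspose n hℏ φ w := by
  rw [symplFourierTranspose_apply, symplFourierTranspose_apply, mul_left_comm]
  congr 1
  rw [← integral_const_mul,
    ← integral_sub_right_eq_self (fun z' => Complex.exp ((Complex.I / ℏ) * sympl z w) *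
      (Complex.exp ((Complex.I / ℏ) * sympl w z') * φ z')) (-z)]
  congr 1
  funext z'
  rw [compSubConstCLM_apply, ← mul_assoc, ← Complex.exp_add]
  congr 2
  have : sympl w (z' - -z) = sympl w z' - sympl z w := by
    simp only [sympl, sub_neg_eq_add, PiLp.add_apply, mul_add, Finset.sum_add_distrib]
    simp only [mul_comm (z _)]
    ring
  rw [this]
  push_cast
  ring

theorem isConvolutor_thetaSigma (n : ℕ) {ℏ : ℝ} (hℏ : 0 < ℏ) :
    IsConvolutor (thetaSigma n hℏ) := by
  refine ⟨((2 * Real.pi * ℏ : ℂ) ^ n) • ((symplFourierTranspose n hℏ).comp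
    ((SchwartzMap.smulLeftCLM ℂ (theta n ℏ)).comp (symplFourierTranspose n hℏ))), fun φ z => ?_⟩
  have h1 : thetaSigma n hℏ (compSubConstCLM ℂ (-z) φ) =
      ∫ w, symplFourierTranspose n hℏ (compSubConstCLM ℂ (-z) φ) w • theta n ℏ w := rfl
  have h2 : (((2 * Real.pi * ℏ : ℂ) ^ n) • ((symplFourierTranspose n hℏ).comp
      ((SchwartzMap.smulLeftCLM ℂ (theta n ℏ)).comp (symplFourierTranspose n hℏ)))) φ z =
      (2 * Real.pi * ℏ : ℂ) ^ n * symplFourierTranspose n hℏ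
        (SchwartzMap.smulLeftCLM ℂ (theta n ℏ) (symplFourierTranspose n hℏ φ)) z := rfl
  have h3 : (2 * Real.pi * ℏ : ℂ) ≠ 0 := by
    have := Real.pi_pos
    exact_mod_cast (by positivity : (2 * Real.pi * ℏ : ℝ) ≠ 0)
  rw [h1, h2, symplFourierTranspose_apply, ← mul_assoc, ← mul_pow, mul_one_div_cancel h3, one_pow,
    one_mul]
  congr 1
  funext w
  rw [symplFourierTranspose_translate,
    SchwartzMap.smulLeftCLM_apply_apply (hasTemperateGrowth_theta n ℏ), smul_eq_mul, smul_eq_mul]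
  ring

end BornJordan

end

/-!
Division by `Θ` is solved by duality. Multiplication by `Θ` is a continuous linear map of the
Schwartz space into itself, and once it is known to be a topological embedding
(`BornJordan.isEmbedding_smulLeftCLM_theta`), the Hahn-Banach theorem extends the functional
`Θ φ ↦ b φ` from its range to a tempered distribution `a` with `Θ a = b`.

The embedding property is the a priori estimate `exists_seminorm_le_of_pow_smul`: every Schwartz
seminorm of `φ` is bounded by a continuous seminorm of `Θ ^ m φ`. For seminorms without derivatives
(`seminorm_zero_le_of_pow_smul`) one uses that `xp` is homogeneous of degree two. The function `Θ`
is bounded below where `|xp / 2ℏ| ≤ π / 2`; any other point has `xp / 2ℏ` within `π / 2` of some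
`π k` with `k ≠ 0`, so a dilation by a factor in `[1/2, 2]` carries it to the zero set, and along
this dilation `Θ` has a simple zero whose slope is bounded below uniformly in `k`
(`BornJordan.hasSimpleRadialZeros_sinc`). Since `Θ ^ m φ` vanishes to order `m` there, Taylor's
theorem on the ray bounds `φ` by the `m`-th derivatives of `Θ ^ m φ`, and polynomial weights change
only by a constant factor. Higher derivatives follow by induction, because `Θ ^ (m + 1) Dφ` is a
first order differential operator with temperate coefficients applied to `Θ ^ m φ`: each
derivative costs one more power of `Θ`, which the estimate allows for.

The convolution statement reduces to division: convolution with `Θ_σ` is multiplication by `Θ`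
conjugated by the symplectic Fourier transform (`BornJordan.conv_thetaSigma_apply`), which is
invertible.
-/

open scoped ContDiff
/-! ### Division by a function with a simple zero on the line -/

section Line

variable {F : Type*} [NormedAddCommGroup F] [NormedSpace ℝ F]

/-- A function divisible by the `m`-th power of a function vanishing at `t₀` is controlled near `t₀`
by its `m`-th derivative alone: all lower derivatives vanish at `t₀`. -/
theorem norm_pow_smul_le {S : Set ℝ} (hS : Convex ℝ S) {t₀ : ℝ} (ht₀ : t₀ ∈ S)
    {θ : ℝ → ℝ} (hθ : ContDiff ℝ ∞ θ) (hθ₀ : θ t₀ = 0) {M : ℝ} (m : ℕ) {g : ℝ → F}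
    (hg : ContDiff ℝ ∞ g)
    (hM : ∀ t ∈ S, ‖iteratedDeriv m (fun t => θ t ^ m • g t) t‖ ≤ M) {t : ℝ} (ht : t ∈ S) :
    ‖θ t ^ m • g t‖ ≤ M * |t - t₀| ^ m := by
  induction m generalizing g t with
  | zero => simpa using hM t ht
  | succ m ih =>
    have hθ' : ContDiff ℝ ∞ (deriv θ) := (contDiff_infty_iff_deriv.1 hθ).2
    have hg' : ContDiff ℝ ∞ (deriv g) := (contDiff_infty_iff_deriv.1 hg).2
    set g₁ : ℝ → F := fun t => ((m + 1 : ℝ) * deriv θ t) • g t + θ t • deriv g t with hg₁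
    have hg₁s : ContDiff ℝ ∞ g₁ := ((contDiff_const.mul hθ').smul hg).add (hθ.smul hg')
    have hder : ∀ t, HasDerivAt (fun t => θ t ^ (m + 1) • g t) (θ t ^ m • g₁ t) t := by
      intro t
      have h1 : HasDerivAt θ (deriv θ t) t :=
        (hθ.differentiable (by simp)).differentiableAt.hasDerivAt
      have h2 : HasDerivAt g (deriv g t) t :=
        (hg.differentiable (by simp)).differentiableAt.hasDerivAt
      convert! (h1.pow (m + 1)).smul h2 using 1
      simp only [hg₁, smul_add, smul_smul, Pi.pow_apply, Nat.add_sub_cancel]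
      rw [add_comm]
      congr 2
      push_cast
      ring
    have hM0 : 0 ≤ M := (norm_nonneg _).trans (hM t ht)
    have hd : deriv (fun t => θ t ^ (m + 1) • g t) = fun t => θ t ^ m • g₁ t :=
      funext fun t => (hder t).deriv
    have hM' : ∀ t ∈ S, ‖iteratedDeriv m (fun t => θ t ^ m • g₁ t) t‖ ≤ M := by
      intro t ht
      rw [← hd, ← iteratedDeriv_succ']
      exact hM t ht
    have hseg : Set.uIcc t₀ t ⊆ S := hS.ordConnected.uIcc_subset ht₀ ht
    have key := (convex_uIcc t₀ t).norm_image_sub_le_of_norm_hasDerivWithin_le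
      (C := M * |t - t₀| ^ m) (fun u _ => (hder u).hasDerivWithinAt) (fun u hu => ?_)
      Set.left_mem_uIcc Set.right_mem_uIcc
    · simpa [hθ₀, pow_succ, mul_assoc] using key
    · refine (ih hg₁s hM' (hseg hu)).trans ?_
      have := Set.abs_sub_left_of_mem_uIcc hu
      gcongr

/-- Division by the `m`-th power of a function with a simple zero costs `m` derivatives. -/
theorem norm_le_of_pow_smul_of_simple_zero {a b t₀ c M : ℝ} (hab : a < b)
    (ht₀ : t₀ ∈ Set.Icc a b) {θ : ℝ → ℝ} (hθ : ContDiff ℝ ∞ θ) (hθ₀ : θ t₀ = 0) (hc : 0 < c)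
    (hθc : ∀ t ∈ Set.Icc a b, c * |t - t₀| ≤ |θ t|) (m : ℕ) {g : ℝ → F} (hg : ContDiff ℝ ∞ g)
    (hM : ∀ t ∈ Set.Icc a b, ‖iteratedDeriv m (fun t => θ t ^ m • g t) t‖ ≤ M)
    {t : ℝ} (ht : t ∈ Set.Icc a b) : c ^ m * ‖g t‖ ≤ M := by
  have hclosed : IsClosed {t : ℝ | c ^ m * ‖g t‖ ≤ M} :=
    isClosed_le (continuous_const.mul hg.continuous.norm) continuous_const
  have hsub : Set.Ioo a b ∩ {t₀}ᶜ ⊆ {t : ℝ | c ^ m * ‖g t‖ ≤ M} := by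
    rintro t ⟨ht, hne⟩
    have ht := Set.Ioo_subset_Icc_self ht
    have hpos : 0 < |t - t₀| ^ m := pow_pos (abs_pos.2 (sub_ne_zero.2 hne)) m
    have h1 := norm_pow_smul_le (convex_Icc a b) ht₀ hθ hθ₀ m hg hM ht
    rw [norm_smul, norm_pow, Real.norm_eq_abs] at h1
    have h2 : (c * |t - t₀|) ^ m ≤ |θ t| ^ m := by
      have := hθc t ht
      gcongr
    refine le_of_mul_le_mul_right ?_ hpos
    calc c ^ m * ‖g t‖ * |t - t₀| ^ m = (c * |t - t₀|) ^ m * ‖g t‖ := by ring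
      _ ≤ |θ t| ^ m * ‖g t‖ := by gcongr
      _ ≤ _ := h1
  -- The zero `t₀` itself is reached by continuity of `g`.
  have hdense : Set.Icc a b ⊆ closure (Set.Ioo a b ∩ {t₀}ᶜ) := by
    rw [← closure_Ioo hab.ne]
    exact closure_minimal ((dense_compl_singleton t₀).open_subset_closure_inter isOpen_Ioo)
      isClosed_closure
  exact hclosed.closure_subset_iff.2 hsub (hdense ht)

end Line

/-! ### Division of Schwartz functions -/

section Schwartz

variable {E : Type} [NormedAddCommGroup E] [NormedSpace ℝ E]

/-- `θ` is bounded below by `c`, except near zeros which are simple along the ray through them,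
with `c` controlling the slope on an interval of dilations that contains `1` and stays
within `[1/2, 2]`. -/
def HasSimpleRadialZeros (θ : E → ℝ) (c : ℝ) : Prop :=
  ∀ z, c ≤ |θ z| ∨ ∃ (z₀ : E) (l a b : ℝ), 1 / 2 ≤ a ∧ a < b ∧ b ≤ 2 ∧ 1 ∈ Set.Icc a b ∧
    l ∈ Set.Icc a b ∧ z = l • z₀ ∧ θ z₀ = 0 ∧ ∀ t ∈ Set.Icc a b, c * |t - 1| ≤ |θ (t • z₀)|

theorem norm_iteratedDeriv_ray_le {F : Type*} [NormedAddCommGroup F] [NormedSpace ℝ F]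
    (h : 𝓢(E, F)) (z₀ : E) (m : ℕ) (t : ℝ) :
    ‖iteratedDeriv m (fun t : ℝ => h (t • z₀)) t‖ ≤
      ‖iteratedFDeriv ℝ m h (t • z₀)‖ * ‖z₀‖ ^ m := by
  have hcomp : (fun t : ℝ => h (t • z₀)) = h ∘ ContinuousLinearMap.toSpanSingleton ℝ z₀ := rfl
  rw [← norm_iteratedFDeriv_eq_norm_iteratedDeriv, hcomp,
    ContinuousLinearMap.iteratedFDeriv_comp_right _ (h.smooth ⊤) t (by exact_mod_cast le_top)]
  refine (ContinuousMultilinearMap.norm_compContinuousLinearMap_le _ _).trans ?_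
  simp

variable {θ : E → ℝ} {c : ℝ}

theorem hasTemperateGrowth_fderiv (hθ : θ.HasTemperateGrowth) :
    (fderiv ℝ θ).HasTemperateGrowth := by
  refine ⟨(contDiff_infty_iff_fderiv.1 hθ.1).2, fun n => ?_⟩
  obtain ⟨k, C, h⟩ := hθ.2 (n + 1)
  exact ⟨k, C, fun x => by simpa only [norm_iteratedFDeriv_fderiv] using h x⟩

/-- The estimate without derivatives. Where `θ` is small, it is the one-dimensional division lemma
on the ray through the nearby zero. -/
theorem seminorm_zero_le_of_pow_smul {F : Type*} [NormedAddCommGroup F] [NormedSpace ℝ F]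
    (hθ : θ.HasTemperateGrowth) (hc : 0 < c) (hz : HasSimpleRadialZeros θ c) (k m : ℕ)
    (φ : 𝓢(E, F)) :
    c ^ m * SchwartzMap.seminorm ℝ k 0 φ ≤
      SchwartzMap.seminorm ℝ k 0 (smulLeftCLM F (θ ^ m) φ) +
        2 ^ (2 * k + m) * SchwartzMap.seminorm ℝ (k + m) m (smulLeftCLM F (θ ^ m) φ) := by
  set h := smulLeftCLM F (θ ^ m) φ with hh
  have hh_apply : ∀ z, h z = θ z ^ m • φ z := fun z =>
    smulLeftCLM_apply_apply (hθ.pow m) φ z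
  have hcm : 0 < c ^ m := pow_pos hc m
  have h0 : 0 ≤ SchwartzMap.seminorm ℝ k 0 h := apply_nonneg _ _
  have h1 : 0 ≤ SchwartzMap.seminorm ℝ (k + m) m h := apply_nonneg _ _
  rw [mul_comm, ← le_div_iff₀ hcm]
  refine seminorm_le_bound ℝ k 0 φ (by positivity) fun z => ?_
  rw [norm_iteratedFDeriv_zero, le_div_iff₀ hcm]
  rcases hz z with hlow | ⟨z₀, l, a, b, ha, hab, hb, h1ab, hl, rfl, hz₀, hslope⟩
  · refine le_add_of_le_of_nonneg ?_ (by positivity)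
    refine le_trans ?_ (norm_pow_mul_le_seminorm ℝ h k z)
    rw [hh_apply, norm_smul, norm_pow, Real.norm_eq_abs, mul_assoc, mul_comm ‖φ z‖]
    gcongr
  · refine le_add_of_nonneg_of_le h0 ?_
    have hl0 : |l| ≤ 2 := abs_le.2 ⟨by linarith [hl.1], hl.2.trans hb⟩
    -- The weight is carried along as a constant factor on the ray.
    set W := ‖l • z₀‖ ^ k with hW
    have hray : ContDiff ℝ ∞ fun t : ℝ => t • z₀ := contDiff_id.smul contDiff_const
    have hfun : (fun t : ℝ => θ (t • z₀) ^ m • (W • φ) (t • z₀)) =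
        fun t : ℝ => (W • h) (t • z₀) := by
      funext t
      simp only [_root_.smul_apply, hh_apply, smul_comm W]
    have key := norm_le_of_pow_smul_of_simple_zero
      (M := 2 ^ (2 * k + m) * SchwartzMap.seminorm ℝ (k + m) m h) hab h1ab
      (θ := fun t => θ (t • z₀)) (hθ.1.comp hray) (by simpa using hz₀) hc hslope m
      (((W • φ).smooth ⊤).comp hray) (fun t ht => ?_) hl
    · have e : ‖(W • φ) (l • z₀)‖ = W * ‖φ (l • z₀)‖ := by
        rw [_root_.smul_apply, norm_smul, Real.norm_of_nonneg (by positivity)]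
      simp only [Function.comp_def, e] at key
      linarith
    · simp only [Function.comp_def]
      rw [hfun]
      refine (norm_iteratedDeriv_ray_le (W • h) z₀ m t).trans ?_
      have hcoe : ((W • h : 𝓢(E, F)) : E → F) = W • (h : E → F) := rfl
      rw [hcoe, iteratedFDeriv_const_smul_apply (h.smooth m).contDiffAt, norm_smul,
        Real.norm_of_nonneg (by positivity)]
      have ht0 : 1 / 2 ≤ |t| := (ha.trans ht.1).trans (le_abs_self t)
      have hz₀t : ‖z₀‖ ≤ 2 * ‖t • z₀‖ := by
        rw [norm_smul, Real.norm_eq_abs]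
        nlinarith [norm_nonneg z₀]
      have hWz : W ≤ (2 * ‖z₀‖) ^ k := by
        rw [hW, norm_smul, Real.norm_eq_abs]
        gcongr
      calc W * ‖iteratedFDeriv ℝ m h (t • z₀)‖ * ‖z₀‖ ^ m
          ≤ (2 * ‖z₀‖) ^ k * ‖iteratedFDeriv ℝ m h (t • z₀)‖ * ‖z₀‖ ^ m := by gcongr
        _ = 2 ^ k * ‖z₀‖ ^ (k + m) * ‖iteratedFDeriv ℝ m h (t • z₀)‖ := by ring
        _ ≤ 2 ^ k * (2 * ‖t • z₀‖) ^ (k + m) * ‖iteratedFDeriv ℝ m h (t • z₀)‖ := by gcongr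
        _ = 2 ^ (2 * k + m) *
            (‖t • z₀‖ ^ (k + m) * ‖iteratedFDeriv ℝ m h (t • z₀)‖) := by ring
        _ ≤ _ := by
          gcongr
          exact le_seminorm ℝ (k + m) m h (t • z₀)

theorem seminorm_succ_eq {F : Type*} [NormedAddCommGroup F] [NormedSpace ℝ F] (k n : ℕ)
    (φ : 𝓢(E, F)) :
    SchwartzMap.seminorm ℝ k (n + 1) φ = SchwartzMap.seminorm ℝ k n (fderivCLM ℝ E F φ) := by
  have h : ∀ z, ‖iteratedFDeriv ℝ n (fderivCLM ℝ E F φ) z‖ = ‖iteratedFDeriv ℝ (n + 1) φ z‖ :=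
    fun z => norm_iteratedFDeriv_fderiv
  refine le_antisymm ?_ ?_
  · refine seminorm_le_bound ℝ k _ _ (apply_nonneg _ _) fun z => ?_
    rw [← h]
    exact le_seminorm ℝ _ _ _ _
  · refine seminorm_le_bound ℝ k _ _ (apply_nonneg _ _) fun z => ?_
    rw [h]
    exact le_seminorm ℝ _ _ _ _

/-- Every Schwartz seminorm of `φ` is bounded by a continuous seminorm of `θ ^ m φ`. The exponent is
free so that the induction on the order of derivatives closes: `θ ^ (m + 1) Dφ` is the result of
applying a first order differential operator with temperate coefficients to `θ ^ m φ`. -/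
theorem exists_seminorm_le_of_pow_smul (hθ : θ.HasTemperateGrowth) (hc : 0 < c)
    (hz : HasSimpleRadialZeros θ c) (n : ℕ) :
    ∀ (F : Type) [NormedAddCommGroup F] [NormedSpace ℝ F] (k m : ℕ),
      ∃ q : Seminorm ℝ 𝓢(E, F), Continuous q ∧
        ∀ φ : 𝓢(E, F), SchwartzMap.seminorm ℝ k n φ ≤ q (smulLeftCLM F (θ ^ m) φ) := by
  induction n with
  | zero =>
    intro F _ _ k m
    let p : ℕ → ℕ → Seminorm ℝ 𝓢(E, F) := fun k n => SchwartzMap.seminorm ℝ k n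
    have hcont : ∀ k n, Continuous (p k n) :=
      fun k n => (schwartz_withSeminorms ℝ E F).continuous_seminorm (k, n)
    have hcm : 0 < c ^ m := pow_pos hc m
    refine ⟨Real.toNNReal (c ^ m)⁻¹ • (p k 0 +
      (2 ^ (2 * k + m) : NNReal) • p (k + m) m), ?_, fun φ => ?_⟩
    · exact ((hcont k 0).add ((hcont (k + m) m).const_smul _)).const_smul _
    · have := seminorm_zero_le_of_pow_smul hθ hc hz k m φ
      simp only [_root_.smul_apply, _root_.add_apply, NNReal.smul_def, smul_eq_mul,
        Real.coe_toNNReal _ (inv_nonneg.2 hcm.le), NNReal.coe_pow, NNReal.coe_ofNat]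
      rwa [← div_eq_inv_mul, le_div_iff₀ hcm, mul_comm]
  | succ n ih =>
    intro F _ _ k m
    obtain ⟨q, hq, hqle⟩ := ih (E →L[ℝ] F) k (m + 1)
    have hdθ : (fderiv ℝ θ).HasTemperateGrowth := hasTemperateGrowth_fderiv hθ
    let B : F →L[ℝ] (E →L[ℝ] ℝ) →L[ℝ] (E →L[ℝ] F) :=
      (ContinuousLinearMap.smulRightL ℝ E F).flip
    let T : 𝓢(E, F) →L[ℝ] 𝓢(E, E →L[ℝ] F) :=
      (smulLeftCLM (E →L[ℝ] F) θ).comp (fderivCLM ℝ E F) - (m : ℝ) • bilinLeftCLM B hdθ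
    refine ⟨q.comp (T : 𝓢(E, F) →ₗ[ℝ] 𝓢(E, E →L[ℝ] F)), hq.comp T.continuous, fun φ => ?_⟩
    have hT : smulLeftCLM (E →L[ℝ] F) (θ ^ (m + 1)) (fderivCLM ℝ E F φ) =
        T (smulLeftCLM F (θ ^ m) φ) := by
      ext1 z
      have h1 : HasFDerivAt θ (fderiv ℝ θ z) z :=
        (hθ.1.differentiable (by simp)).differentiableAt.hasFDerivAt
      have h2 : fderiv ℝ (smulLeftCLM F (θ ^ m) φ) z =
          θ z ^ m • fderiv ℝ φ z + ((m * θ z ^ (m - 1)) • fderiv ℝ θ z).smulRight (φ z) := by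
        rw [smulLeftCLM_apply (hθ.pow m)]
        have := ((h1.pow m).smul (φ.hasFDerivAt z)).fderiv
        simpa using! this
      have h3 : T (smulLeftCLM F (θ ^ m) φ) z =
          θ z • fderiv ℝ (smulLeftCLM F (θ ^ m) φ) z -
            (m : ℝ) • (fderiv ℝ θ z).smulRight (θ z ^ m • φ z) := by
        have h4 : smulLeftCLM F (θ ^ m) φ z = θ z ^ m • φ z :=
          smulLeftCLM_apply_apply (hθ.pow m) φ z
        have h5 : bilinLeftCLM B hdθ (smulLeftCLM F (θ ^ m) φ) z =
            (fderiv ℝ θ z).smulRight (smulLeftCLM F (θ ^ m) φ z) := rfl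
        rw [← h4, ← h5, ← fderivCLM_apply ℝ, ← smulLeftCLM_apply_apply hθ]
        rfl
      rw [h3, h2, smulLeftCLM_apply_apply (hθ.pow (m + 1)), fderivCLM_apply]
      ext v
      rcases m with _ | m
      · simp
      · simp only [Pi.pow_apply, Nat.add_sub_cancel, _root_.smul_apply,
          _root_.sub_apply, _root_.add_apply,
          ContinuousLinearMap.smulRight_apply, smul_add, smul_smul, smul_eq_mul]
        module
    rw [seminorm_succ_eq]
    refine (hqle (fderivCLM ℝ E F φ)).trans ?_
    rw [hT]
    rfl

end Schwartz

/-! ### Surjectivity of the transpose by the Hahn-Banach theorem -/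

section Duality

open Topology

/-- The transpose of a topological embedding of locally convex spaces is surjective. -/
theorem exists_comp_eq_of_isEmbedding {X Y : Type*} [AddCommGroup X] [Module ℂ X]
    [TopologicalSpace X] [AddCommGroup Y] [Module ℂ Y] [TopologicalSpace Y]
    [PolynormableSpace ℂ Y] (A : X →L[ℂ] Y) (hA : IsEmbedding A) (b : X →L[ℂ] ℂ) :
    ∃ a : Y →L[ℂ] ℂ, ∀ x, a (A x) = b x := by
  obtain ⟨q, hq, hbq⟩ := Seminorm.exists_le_comp_of_isInducing (f := (A : X →ₗ[ℂ] Y))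
    (p := b.toSeminorm) b.continuous.norm hA.isInducing
  let e := LinearEquiv.ofInjective (A : X →ₗ[ℂ] Y) hA.injective
  obtain ⟨a, ha, -⟩ := Module.Dual.exists_continuous_extension_of_le_seminorm
    (LinearMap.range (A : X →ₗ[ℂ] Y)) ((b : X →ₗ[ℂ] ℂ) ∘ₗ e.symm.toLinearMap) hq (fun y => by
      obtain ⟨x, rfl⟩ := e.surjective y
      simpa using! hbq x)
  refine ⟨a, fun x => ?_⟩
  have := ha (e x)
  rwa [LinearMap.comp_apply, LinearEquiv.coe_coe, e.symm_apply_apply] at this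

variable {E : Type} [NormedAddCommGroup E] [NormedSpace ℝ E] {θ : E → ℝ} {c : ℝ}

/-- Multiplication by `θ` is a topological embedding, since the Schwartz seminorms of `φ` are
controlled by those of `θ φ`. -/
theorem isEmbedding_smulLeftCLM (hθ : θ.HasTemperateGrowth) (hc : 0 < c)
    (hz : HasSimpleRadialZeros θ c) (F : Type) [NormedAddCommGroup F] [NormedSpace ℝ F] :
    IsEmbedding (smulLeftCLM F θ : 𝓢(E, F) →L[ℝ] 𝓢(E, F)) := by
  have hind : IsInducing (smulLeftCLM F θ : 𝓢(E, F) →L[ℝ] 𝓢(E, F)) := by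
    rw [IsTopologicalAddGroup.isInducing_iff_nhds_zero]
    refine le_antisymm ?_ ?_
    · rw [← Filter.map_le_iff_le_comap]
      exact ((smulLeftCLM F θ : 𝓢(E, F) →L[ℝ] 𝓢(E, F)).continuous.tendsto' 0 0 (map_zero _))
    · refine Filter.tendsto_id'.1 <|
        ((schwartz_withSeminorms ℝ E F).tendsto_nhds id 0).2 fun ⟨k, n⟩ ε hε => ?_
      obtain ⟨q, hq, hle⟩ := exists_seminorm_le_of_pow_smul hθ hc hz n F k 1
      have hq0 : ∀ᶠ ψ in 𝓝 (0 : 𝓢(E, F)), q ψ < ε :=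
        (hq.tendsto' 0 0 (map_zero q)).eventually (gt_mem_nhds hε)
      filter_upwards [Filter.tendsto_comap.eventually hq0] with φ hφ
      have := hle φ
      rw [pow_one] at this
      simpa using this.trans_lt hφ
  exact ⟨hind, hind.injective⟩

end Duality

namespace BornJordan

variable {n : ℕ}

/-! ### The zeros of the Born-Jordan kernel -/

theorem dotXP_smul (t : ℝ) (z : PhaseSpace n) : dotXP (t • z) = t ^ 2 * dotXP z := by
  simp only [dotXP, PiLp.smul_apply, smul_eq_mul, Finset.mul_sum]
  exact Finset.sum_congr rfl fun j _ => by ring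

/-- Along a ray that meets the zero set `xp / 2ℏ = π k`, `k ≠ 0`, at `t = 1`, the simple zero of the
kernel has a slope bounded below independently of `k`. -/
theorem le_abs_sinc_sq_mul {k : ℤ} (hk : k ≠ 0) {t : ℝ} (ht₀ : 0 < t) (ht₂ : t ≤ 2)
    (ht : |t ^ 2 - 1| ≤ 1 / (2 * |(k : ℝ)|)) :
    1 / (2 * Real.pi) * |t - 1| ≤ |Real.sinc (t ^ 2 * (k * Real.pi))| := by
  have hπ := Real.pi_pos
  have hk' : 0 < |(k : ℝ)| := abs_pos.2 (Int.cast_ne_zero.2 hk)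
  have hne : t ^ 2 * (k * Real.pi) ≠ 0 := by
    have : (k : ℝ) ≠ 0 := Int.cast_ne_zero.2 hk
    positivity
  have hx : |(k : ℝ) * Real.pi * (t ^ 2 - 1)| = |(k : ℝ)| * Real.pi * |t ^ 2 - 1| := by
    rw [abs_mul, abs_mul, abs_of_pos hπ]
  have hsmall : |(k : ℝ) * Real.pi * (t ^ 2 - 1)| ≤ Real.pi / 2 := by
    rw [hx]
    calc |(k : ℝ)| * Real.pi * |t ^ 2 - 1| ≤ |(k : ℝ)| * Real.pi * (1 / (2 * |(k : ℝ)|)) := by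
          gcongr
      _ = Real.pi / 2 := by field_simp
  have hsin : |Real.sin (t ^ 2 * (k * Real.pi))| = |Real.sin (k * Real.pi * (t ^ 2 - 1))| := by
    rw [show (k : ℝ) * Real.pi * (t ^ 2 - 1) = t ^ 2 * (k * Real.pi) - k * Real.pi by ring,
      Real.sin_sub_int_mul_pi, abs_mul, abs_zpow, abs_neg, abs_one, one_zpow, one_mul]
  have hfac : |t - 1| ≤ |t ^ 2 - 1| := by
    rw [show t ^ 2 - 1 = (t - 1) * (t + 1) by ring, abs_mul]
    exact le_mul_of_one_le_right (abs_nonneg _) (by rw [abs_of_pos] <;> linarith)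
  rw [Real.sinc_of_ne_zero hne, abs_div, le_div_iff₀ (abs_pos.2 hne), hsin]
  refine le_trans ?_ (Real.mul_abs_le_abs_sin hsmall)
  rw [hx, abs_mul, abs_mul, abs_of_pos hπ, abs_of_pos (by positivity : 0 < t ^ 2)]
  have ht4 : t ^ 2 ≤ 4 := by nlinarith
  calc 1 / (2 * Real.pi) * |t - 1| * (t ^ 2 * (|(k : ℝ)| * Real.pi))
      ≤ 1 / (2 * Real.pi) * |t ^ 2 - 1| * (4 * (|(k : ℝ)| * Real.pi)) := by gcongr
    _ = 2 / Real.pi * (|(k : ℝ)| * Real.pi * |t ^ 2 - 1|) := by ring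

/-- The zero associated with a point is found on its ray, at the multiple `π k` of `π` nearest to
`xp / 2ℏ`; for `k = 0` there is no zero and `sinc` is at least `2 / π`. -/
theorem hasSimpleRadialZeros_sinc (n : ℕ) (ℏ : ℝ) :
    HasSimpleRadialZeros (fun z : PhaseSpace n => Real.sinc (dotXP z / (2 * ℏ)))
      (1 / (2 * Real.pi)) := by
  have hπ := Real.pi_pos
  intro z
  set s := dotXP z / (2 * ℏ) with hs
  have hround := abs_sub_round (s / Real.pi)
  set k := round (s / Real.pi) with hk
  have hsk : |s - k * Real.pi| ≤ Real.pi / 2 := by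
    rw [show s - k * Real.pi = (s / Real.pi - k) * Real.pi by field_simp, abs_mul, abs_of_pos hπ]
    linarith [mul_le_mul_of_nonneg_right hround hπ.le]
  by_cases hk0 : k = 0
  · left
    change _ ≤ |Real.sinc s|
    have hc : 1 / (2 * Real.pi) ≤ 2 / Real.pi := by
      rw [div_le_div_iff₀ (by positivity) hπ]
      linarith
    refine hc.trans ?_
    by_cases hs0 : s = 0
    · rw [hs0, Real.sinc_zero, abs_one, div_le_one hπ]
      exact Real.two_le_pi
    · rw [hk0, Int.cast_zero, zero_mul, sub_zero] at hsk
      rw [Real.sinc_of_ne_zero hs0, abs_div, le_div_iff₀ (abs_pos.2 hs0)]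
      exact Real.mul_abs_le_abs_sin hsk
  · right
    have hkR : (k : ℝ) ≠ 0 := Int.cast_ne_zero.2 hk0
    have hk1 : 1 ≤ |(k : ℝ)| := by exact_mod_cast Int.one_le_abs hk0
    -- `r` is the square of the dilation that carries `z` to the zero set.
    set d := 1 / (2 * |(k : ℝ)|) with hd
    set r := s / (k * Real.pi) with hr
    have hd0 : 0 < d := by positivity
    have hd1 : d ≤ 1 / 2 := one_div_le_one_div_of_le (by norm_num) (by linarith)
    have hrd : |r - 1| ≤ d := by
      rw [hr, show s / (k * Real.pi) - 1 = (s - k * Real.pi) / (k * Real.pi) by field_simp,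
        abs_div, abs_mul (k : ℝ), abs_of_pos hπ, div_le_iff₀ (by positivity), hd]
      refine hsk.trans (le_of_eq ?_)
      field_simp
    rw [abs_le] at hrd
    have hr0 : 0 < r := by linarith
    have hl0 : 0 < √r := Real.sqrt_pos.2 hr0
    have hz₀ : ∀ t : ℝ, dotXP (t • (√r)⁻¹ • z) / (2 * ℏ) = t ^ 2 * (k * Real.pi) := by
      intro t
      have hsr : s = r * (k * Real.pi) := by rw [hr]; field_simp
      rw [dotXP_smul, dotXP_smul, inv_pow, Real.sq_sqrt hr0.le, mul_div_assoc, mul_div_assoc,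
        ← hs, hsr]
      field_simp
    have ha : 1 / 2 ≤ √(1 - d) := Real.le_sqrt_of_sq_le (by linarith)
    have hb : √(1 + d) ≤ 2 := Real.sqrt_le_iff.2 ⟨by norm_num, by linarith⟩
    refine ⟨(√r)⁻¹ • z, √r, √(1 - d), √(1 + d), ha,
      Real.sqrt_lt_sqrt (by linarith) (by linarith), hb,
      ⟨Real.sqrt_le_one.2 (by linarith), Real.one_le_sqrt.2 (by linarith)⟩,
      ⟨Real.sqrt_le_sqrt (by linarith), Real.sqrt_le_sqrt (by linarith)⟩,
      (smul_inv_smul₀ hl0.ne' z).symm, ?_, fun t ht => ?_⟩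
    · have h1 := hz₀ 1
      rw [one_smul, one_pow, one_mul] at h1
      simp only [h1]
      rw [Real.sinc_of_ne_zero (by positivity), Real.sin_int_mul_pi, zero_div]
    · simp only [hz₀]
      have ht0 : 0 < t := by linarith [ht.1]
      have h1 : 1 - d ≤ t ^ 2 := (Real.sqrt_le_left ht0.le).1 ht.1
      have h2 : t ^ 2 ≤ 1 + d := (Real.le_sqrt ht0.le (by linarith)).1 ht.2
      exact le_abs_sinc_sq_mul hk0 ht0 (ht.2.trans hb)
        (abs_le.2 ⟨by linarith, by linarith⟩)

/-! ### Division by the kernel and deconvolution -/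

theorem isEmbedding_smulLeftCLM_theta (n : ℕ) (ℏ : ℝ) :
    Topology.IsEmbedding
      (SchwartzMap.smulLeftCLM ℂ (theta n ℏ) :
        𝓢(PhaseSpace n, ℂ) →L[ℂ] 𝓢(PhaseSpace n, ℂ)) := by
  have hθ : (fun z : PhaseSpace n => Real.sinc (dotXP z / (2 * ℏ))).HasTemperateGrowth :=
    Complex.reCLM.hasTemperateGrowth.comp (hasTemperateGrowth_theta n ℏ)
  have h := isEmbedding_smulLeftCLM hθ (by have := Real.pi_pos; positivity)
    (hasSimpleRadialZeros_sinc n ℏ) ℂ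
  convert! h using 1
  funext φ
  exact smulLeftCLM_ofReal ℂ hθ φ

theorem exists_comp_smulLeftCLM_theta_eq (n : ℕ) (ℏ : ℝ) (b : 𝓢(PhaseSpace n, ℂ) →L[ℂ] ℂ) :
    ∃ a : 𝓢(PhaseSpace n, ℂ) →L[ℂ] ℂ,
      ∀ φ, a (SchwartzMap.smulLeftCLM ℂ (theta n ℏ) φ) = b φ := by
  have : PolynormableSpace ℂ 𝓢(PhaseSpace n, ℂ) :=
    (schwartz_withSeminorms ℂ (PhaseSpace n) ℂ).toPolynormableSpace
  exact exists_comp_eq_of_isEmbedding _ (isEmbedding_smulLeftCLM_theta n ℏ) b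

theorem exists_leftInverse_symplFourierTranspose (n : ℕ) {ℏ : ℝ} (hℏ : 0 < ℏ) :
    ∃ S : 𝓢(PhaseSpace n, ℂ) →L[ℂ] 𝓢(PhaseSpace n, ℂ),
      ∀ φ, S (symplFourierTranspose n hℏ φ) = φ := by
  have h3 : (1 / (2 * Real.pi * ℏ : ℂ)) ^ n ≠ 0 := by
    have h1 : (Real.pi : ℂ) ≠ 0 := by exact_mod_cast Real.pi_ne_zero
    have h2 : (ℏ : ℂ) ≠ 0 := by exact_mod_cast hℏ.ne'
    exact pow_ne_zero n (one_div_ne_zero (mul_ne_zero (mul_ne_zero two_ne_zero h1) h2))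
  refine ⟨((1 / (2 * Real.pi * ℏ : ℂ)) ^ n)⁻¹ •
    ((FourierTransform.fourierCLE ℂ 𝓢(PhaseSpace n, ℂ)).symm.toContinuousLinearMap.comp
      ((compCLMOfContinuousLinearEquiv ℂ (scaledJ n hℏ).symm).comp (reflect n))), fun φ => ?_⟩
  have h4 : compCLMOfContinuousLinearEquiv ℂ (scaledJ n hℏ).symm
      (reflect n (symplFourierTranspose n hℏ φ)) =
      (1 / (2 * Real.pi * ℏ : ℂ)) ^ n • FourierTransform.fourierCLE ℂ 𝓢(PhaseSpace n, ℂ) φ := by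
    ext z
    change (1 / (2 * Real.pi * ℏ : ℂ)) ^ n •
      FourierTransform.fourierCLE ℂ 𝓢(PhaseSpace n, ℂ) φ
        (scaledJ n hℏ (- -((scaledJ n hℏ).symm z))) = _
    rw [neg_neg, ContinuousLinearEquiv.apply_symm_apply]
    rfl
  rw [_root_.smul_apply, ContinuousLinearMap.comp_apply, ContinuousLinearMap.comp_apply, h4,
    map_smul, smul_smul, inv_mul_cancel₀ h3, one_smul]
  exact ContinuousLinearEquiv.symm_apply_apply _ φ

/-- Convolution with `Θ_σ` is multiplication by `Θ` conjugated by the symplectic Fourier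
transform. -/
theorem conv_thetaSigma_apply (n : ℕ) {ℏ : ℝ} (hℏ : 0 < ℏ) (a : 𝓢'(PhaseSpace n, ℂ))
    (φ : 𝓢(PhaseSpace n, ℂ)) :
    conv a (thetaSigma n hℏ) (isConvolutor_thetaSigma n hℏ) φ =
      (2 * Real.pi * ℏ : ℂ) ^ n * a (symplFourierTranspose n hℏ
        (SchwartzMap.smulLeftCLM ℂ (theta n ℏ) (symplFourierTranspose n hℏ φ))) := by
  rw [conv_apply a (thetaSigma n hℏ) (isConvolutor_thetaSigma n hℏ) φ
    ((2 * Real.pi * ℏ : ℂ) ^ n • symplFourierTranspose n hℏ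
      (SchwartzMap.smulLeftCLM ℂ (theta n ℏ) (symplFourierTranspose n hℏ φ))), map_smul,
    smul_eq_mul]
  intro z
  have h1 : thetaSigma n hℏ (compSubConstCLM ℂ (-z) φ) =
      ∫ w, symplFourierTranspose n hℏ (compSubConstCLM ℂ (-z) φ) w • theta n ℏ w := rfl
  have h3 : (2 * Real.pi * ℏ : ℂ) ≠ 0 := by
    have := Real.pi_pos
    exact_mod_cast (by positivity : (2 * Real.pi * ℏ : ℝ) ≠ 0)
  rw [h1, _root_.smul_apply, smul_eq_mul, symplFourierTranspose_apply, ← mul_assoc,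
    ← mul_pow, mul_one_div_cancel h3, one_pow, one_mul]
  congr 1
  funext w
  rw [symplFourierTranspose_translate,
    SchwartzMap.smulLeftCLM_apply_apply (hasTemperateGrowth_theta n ℏ), smul_eq_mul, smul_eq_mul]
  ring

end BornJordan

theorem theorem5p1 (n : ℕ) {ℏ : ℝ} (hℏ : 0 < ℏ) :
    Function.Surjective (fun a : 𝓢'(BornJordan.PhaseSpace n, ℂ) =>
      ((1 / (2 * Real.pi * ℏ : ℂ)) ^ n) •
        BornJordan.conv a (BornJordan.thetaSigma n hℏ)
          (BornJordan.isConvolutor_thetaSigma n hℏ)) ∧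
    ∀ b : 𝓢'(BornJordan.PhaseSpace n, ℂ), ∃ a : 𝓢'(BornJordan.PhaseSpace n, ℂ),
      TemperedDistribution.smulLeftCLM ℂ (BornJordan.theta n ℏ) a = b := by
  have division : ∀ b : 𝓢'(BornJordan.PhaseSpace n, ℂ),
      ∃ a : 𝓢'(BornJordan.PhaseSpace n, ℂ),
        TemperedDistribution.smulLeftCLM ℂ (BornJordan.theta n ℏ) a = b := by
    intro b
    obtain ⟨a, ha⟩ := BornJordan.exists_comp_smulLeftCLM_theta_eq n ℏ b
    exact ⟨a, by ext φ; exact ha φ⟩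
  refine ⟨fun b => ?_, division⟩
  obtain ⟨S, hS⟩ := BornJordan.exists_leftInverse_symplFourierTranspose n hℏ
  obtain ⟨a, ha⟩ := division (PointwiseConvergenceCLM.precomp ℂ S b)
  refine ⟨PointwiseConvergenceCLM.precomp ℂ S a, ?_⟩
  have h3 : (2 * Real.pi * ℏ : ℂ) ≠ 0 := by
    have := Real.pi_pos
    exact_mod_cast (by positivity : (2 * Real.pi * ℏ : ℝ) ≠ 0)
  ext φ
  have hconv := BornJordan.conv_thetaSigma_apply n hℏ (PointwiseConvergenceCLM.precomp ℂ S a) φ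
  have hdiv := DFunLike.congr_fun ha (BornJordan.symplFourierTranspose n hℏ φ)
  have hpre : ∀ (u : 𝓢'(BornJordan.PhaseSpace n, ℂ)) ψ,
      PointwiseConvergenceCLM.precomp ℂ S u ψ = u (S ψ) := fun _ _ => rfl
  rw [hpre, hS] at hconv
  rw [hpre, hS, TemperedDistribution.smulLeftCLM_apply_apply] at hdiv
  change (1 / (2 * Real.pi * ℏ : ℂ)) ^ n * BornJordan.conv _ _ _ φ = b φ
  rw [hconv, hdiv, ← mul_assoc, ← mul_pow, one_div_mul_cancel h3, one_pow, one_mul]
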